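/- Let $\mathcal H=L^2(\mathbb R)$ be the Hilbert space of a single bosonic mode, with position operator $(\hat x f)(x)=xf(x)$, momentum operator $\hat p=-i\,\mathrm d/\mathrm dx$, mode operator $\hat a=(\hat x+i\hat p)/\sqrt2$, number operator $\hat n=\hat a^\dagger\hat a$, Fock basis $\{|n\rangle\}_{n\ge0}$ (eigenvectors of $\hat n$), coherent states $|\alpha\rangle=e^{-|\alpha|^2/2}\sum_n\frac{\alpha^n}{\sqrt{n!}}|n\rangle$ and quadratures $\hat q_\theta=\cos\theta\,\hat x+\sin\theta\,\hat p$. A state is a positive operator $\hat\rho$ on $\mathcal H$ with trace norm $\|\hat\rho\|_1=1$, and $D(\hat\rho,\hat\sigma)=\frac12\|\hat\rho-\hat\sigma\|_1$ is the trace distance. The stellar rank of a unit vector $\psi$ is the number of zeros in $\mathbb C$, counted with multiplicity, of $\alpha\mapsto e^{|\alpha|^2/2}\langle\alpha^*|\psi\rangle$; the stellar rank of a state $\hat\rho$ is the infimum of $\sup_i r^\star(\psi_i)$ over all finite or countable decompositions $\hat\rho=\sum_ip_i|\psi_i\rangle\langle\psi_i|$ with $p_i\ge0$, $\sum_ip_i=1$,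 $\|\psi_i\|=1$. For $E\ge0$, let $\mathcal S^E$ be the trace-norm closure of the convex hull of the pure states $|\psi\rangle\langle\psi|$ with $\langle\hat n\rangle_\psi\le E$, and let $\mathcal S_0^E$ be the set of states in $\mathcal S^E$ of stellar rank $0$ (the energy-bounded Gaussian states). Let $x\in\mathbb R$, $\theta\in[0,2\pi)$, $\eta>0$ and $E\ge0$. Let $\hat W_{\theta,x,\eta}=\int_{x-\eta/2}^{x+\eta/2}|q\rangle\langle q|_{\hat q_\theta}\,\mathrm dq$ be the spectral projector of $\hat q_\theta$ on $[x-\frac\eta2,x+\frac\eta2]$, and let $w^E_{\theta,x,\eta}=\inf_{\hat\sigma\in\mathcal S_0^E}\mathrm{Tr}(\hat\sigma\hat W_{\theta,x,\eta})$. Then $\mathcal S_0^E$ is non-empty, for every state $\hat\sigma$ the series defining the trace $\mathrm{Tr}(\hat\sigma\hat W_{\theta,x,\eta})$ in the Fock basis converges to a non-negative real number, and for every state $\hat\rho$ the distances $D(\hat\rho,\hat\sigma)$, $\hat\sigma\in\mathcal S_0^E$, are finite and $$w^E_{\theta,x,\eta}-\mathrm{Tr}(\hat\rho\,\hat W_{\theta,x,\eta})\le\inf_{\hat\sigma\in\mathcal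 S_0^E}D(\hat\rho,\hat\sigma).$$ That is, the violation of the witness is a lower bound on the distance from $\hat\rho$ to the set of energy-bounded Gaussian states. -/

import Mathlib

open scoped ENNReal InnerProductSpace

namespace BosonicMode

open MeasureTheory SchwartzMap
open scoped ContDiff FourierTransform

noncomputable section

/-- The modulus `|T| = √(T* T)` of a bounded operator on a Hilbert space. -/
def absOp {H : Type*} [NormedAddCommGroup H] [InnerProductSpace ℂ H] [CompleteSpace H]
    (T : H →L[ℂ] H) : H →L[ℂ] H := CFC.abs T

/-- All finite convex combinations of the operators in `S`. -/
def mixtures {H : Type*} [NormedAddCommGroup H] [InnerProductSpace ℂ H] (S : Set (H →L[ℂ] H)) :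
    Set (H →L[ℂ] H) := convexHull ℝ S

/-- The Hilbert space `L²(ℝ)` of a single bosonic mode. -/
abbrev ModeSpace : Type := Lp ℂ 2 (volume : Measure ℝ)

theorem hasTemperateGrowth_ofReal : (fun x : ℝ => (x : ℂ)).HasTemperateGrowth :=
  Complex.ofRealCLM.hasTemperateGrowth

/-- The position operator on Schwartz functions, `(x̂ f)(x) = x f(x)`. -/
def positionOp : 𝓢(ℝ, ℂ) →L[ℂ] 𝓢(ℝ, ℂ) := smulLeftCLM ℂ (fun x : ℝ => (x : ℂ))
/-- The momentum operator on Schwartz functions, `p̂ f = -i f'`. -/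
def momentumOp : 𝓢(ℝ, ℂ) →L[ℂ] 𝓢(ℝ, ℂ) := (-Complex.I) • derivCLM ℂ ℂ
/-- The mode operator `â = (x̂ + i p̂) / √2`. -/
def annihilationOp : 𝓢(ℝ, ℂ) →L[ℂ] 𝓢(ℝ, ℂ) :=
  ((1 / √2 : ℝ) : ℂ) • (positionOp + Complex.I • momentumOp)
/-- The adjoint mode operator `â† = (x̂ - i p̂) / √2`. -/
def creationOp : 𝓢(ℝ, ℂ) →L[ℂ] 𝓢(ℝ, ℂ) :=
  ((1 / √2 : ℝ) : ℂ) • (positionOp - Complex.I • momentumOp)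

/-- The number operator `n̂ = â† â`. -/
def numberOp : 𝓢(ℝ, ℂ) →L[ℂ] 𝓢(ℝ, ℂ) := creationOp ∘L annihilationOp

/-- The quadrature operator `q̂_θ = cos θ x̂ + sin θ p̂`. -/
def quadratureOp (θ : ℝ) : 𝓢(ℝ, ℂ) →L[ℂ] 𝓢(ℝ, ℂ) :=
  (Real.cos θ : ℂ) • positionOp + (Real.sin θ : ℂ) • momentumOp

theorem positionOp_apply (f : 𝓢(ℝ, ℂ)) (x : ℝ) : positionOp f x = x * f x := by
  simp [positionOp, smulLeftCLM_apply_apply hasTemperateGrowth_ofReal]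
theorem momentumOp_apply (f : 𝓢(ℝ, ℂ)) (x : ℝ) : momentumOp f x = -Complex.I * deriv f x := by
  simp [momentumOp]
theorem annihilationOp_apply (f : 𝓢(ℝ, ℂ)) (x : ℝ) :
    annihilationOp f x = ((1 / √2 : ℝ) : ℂ) * (x * f x + deriv f x) := by
  simp [annihilationOp, positionOp_apply, momentumOp_apply, ← mul_assoc, mul_add]
theorem creationOp_apply (f : 𝓢(ℝ, ℂ)) (x : ℝ) :
    creationOp f x = ((1 / √2 : ℝ) : ℂ) * (x * f x - deriv f x) := by
  simp [creationOp, positionOp_apply, momentumOp_apply, ← mul_assoc, mul_add,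
    sub_eq_add_neg]

theorem polyGauss_bounded (P : Polynomial ℝ) :
    ∃ C : ℝ, ∀ x : ℝ, |P.eval x| * Real.exp (-(x ^ 2 / 2)) ≤ C := by
  induction P using Polynomial.induction_on' with
  | add p q hp hq =>
    obtain ⟨C, hC⟩ := hp
    obtain ⟨D, hD⟩ := hq
    refine ⟨C + D, fun x => ?_⟩
    have := abs_add_le (p.eval x) (q.eval x)
    rw [Polynomial.eval_add]
    nlinarith [hC x, hD x, Real.exp_pos (-(x ^ 2 / 2))]
  | monomial n a =>
    refine ⟨|a| * (1 + 2 ^ n * n.factorial), fun x => ?_⟩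
    have h1 := Real.pow_div_factorial_le_exp (x ^ 2 / 2) (by positivity) n
    have h2 : |x| ^ n ≤ 1 + (x ^ 2) ^ n := by
      rw [← sq_abs, ← pow_mul, mul_comm, pow_mul]
      nlinarith [sq_nonneg (|x| ^ n - 1), sq_nonneg (|x| ^ n)]
    have h3 : (x ^ 2) ^ n ≤ 2 ^ n * n.factorial * Real.exp (x ^ 2 / 2) := by
      rw [div_pow, div_div, div_le_iff₀ (by positivity)] at h1
      linarith
    have h4 : 1 ≤ Real.exp (x ^ 2 / 2) := Real.one_le_exp (by positivity)
    have h5 : |x| ^ n ≤ (1 + 2 ^ n * n.factorial) * Real.exp (x ^ 2 / 2) := by linarith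
    rw [Polynomial.eval_monomial, abs_mul, abs_pow, Real.exp_neg, mul_assoc]
    refine mul_le_mul_of_nonneg_left ?_ (abs_nonneg a)
    rwa [← div_eq_mul_inv, div_le_iff₀ (Real.exp_pos _)]

theorem hasDerivAt_gaussExponent (x : ℝ) :
    HasDerivAt (fun x : ℝ => -(x ^ 2 / 2)) (-x) x :=
  (((hasDerivAt_pow 2 x).div_const 2).neg).congr_deriv (by push_cast; ring)

theorem iteratedDeriv_polyGauss (n : ℕ) : ∀ P : Polynomial ℝ, ∃ Q : Polynomial ℝ,
    iteratedDeriv n (fun x : ℝ => ((P.eval x * Real.exp (-(x ^ 2 / 2)) : ℝ) : ℂ)) =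
      fun x : ℝ => ((Q.eval x * Real.exp (-(x ^ 2 / 2)) : ℝ) : ℂ) := by
  induction n with
  | zero => exact fun P => ⟨P, by simp⟩
  | succ n ih =>
    intro P
    obtain ⟨Q, hQ⟩ := ih (P.derivative - Polynomial.X * P)
    refine ⟨Q, ?_⟩
    rw [← hQ, iteratedDeriv_succ']
    congr 1
    funext x
    have h := ((P.hasDerivAt x).mul (hasDerivAt_gaussExponent x).exp).ofReal_comp
    refine h.deriv.trans ?_
    simp only [Polynomial.eval_sub, Polynomial.eval_mul, Polynomial.eval_X]
    push_cast
    ring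

/-- The vacuum wavefunction `π ^ (-1/4) exp (-x² / 2)`, as a Schwartz function. -/
def vacuumFun : 𝓢(ℝ, ℂ) where
  toFun x := ((Real.pi ^ (-(1 / 4) : ℝ) * Real.exp (-(x ^ 2 / 2)) : ℝ) : ℂ)
  smooth' := by
    have h : ContDiff ℝ ∞ (fun x : ℝ => Real.pi ^ (-(1 / 4) : ℝ) * Real.exp (-(x ^ 2 / 2))) := by
      fun_prop
    exact Complex.ofRealCLM.contDiff.comp h
  decay' k n := by
    obtain ⟨Q, hQ⟩ := iteratedDeriv_polyGauss n (Polynomial.C (Real.pi ^ (-(1 / 4) : ℝ)))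
    obtain ⟨C, hC⟩ := polyGauss_bounded (Polynomial.X ^ k * Q)
    refine ⟨C, fun x => ?_⟩
    have h := congrFun hQ x
    simp only [Polynomial.eval_C] at h
    rw [norm_iteratedFDeriv_eq_norm_iteratedDeriv, h, Complex.norm_real]
    refine le_trans (le_of_eq ?_) (hC x)
    simp [abs_mul, mul_assoc]

theorem vacuumFun_apply (x : ℝ) :
    vacuumFun x = ((Real.pi ^ (-(1 / 4) : ℝ) * Real.exp (-(x ^ 2 / 2)) : ℝ) : ℂ) := rfl

theorem deriv_vacuumFun (x : ℝ) : deriv vacuumFun x = -(x * vacuumFun x) := by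
  have h := (((hasDerivAt_gaussExponent x).exp).const_mul (Real.pi ^ (-(1 / 4) : ℝ))).ofReal_comp
  refine h.deriv.trans ?_
  rw [vacuumFun_apply]
  push_cast
  ring

theorem annihilationOp_vacuumFun : annihilationOp vacuumFun = 0 := by
  ext x
  rw [annihilationOp_apply, deriv_vacuumFun]
  simp

theorem sqrt_two_inv_sq : ((1 / √2 : ℝ) : ℂ) * ((1 / √2 : ℝ) : ℂ) = 1 / 2 := by
  rw [← Complex.ofReal_mul, ← sq, div_pow, Real.sq_sqrt (by norm_num)]
  norm_num

theorem annihilationOp_creationOp (f : 𝓢(ℝ, ℂ)) :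
    annihilationOp (creationOp f) = creationOp (annihilationOp f) + f := by
  have hx (g : 𝓢(ℝ, ℂ)) (x : ℝ) :
      deriv (positionOp g) x = g x + x * deriv g x := by
    have h := (Complex.ofRealCLM.hasDerivAt (x := x)).mul (g.hasDerivAt x)
    have e : (positionOp g : ℝ → ℂ) = fun x : ℝ => (x : ℂ) * g x := funext (positionOp_apply g)
    rw [e]
    refine h.deriv.trans ?_
    simp
  have hc : (creationOp f : 𝓢(ℝ, ℂ)) =
      ((1 / √2 : ℝ) : ℂ) • (positionOp f - derivCLM ℂ ℂ f) := by
    ext x; simp [creationOp_apply, positionOp_apply]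
  have ha : (annihilationOp f : 𝓢(ℝ, ℂ)) =
      ((1 / √2 : ℝ) : ℂ) • (positionOp f + derivCLM ℂ ℂ f) := by
    ext x; simp [annihilationOp_apply, positionOp_apply]; ring
  have d1 (x : ℝ) : deriv (creationOp f) x =
      ((1 / √2 : ℝ) : ℂ) * (f x + x * deriv f x - deriv (derivCLM ℂ ℂ f) x) := by
    rw [hc, ← hx, ← derivCLM_apply ℂ, map_smul, map_sub]
    simp
  have d2 (x : ℝ) : deriv (annihilationOp f) x =
      ((1 / √2 : ℝ) : ℂ) * (f x + x * deriv f x + deriv (derivCLM ℂ ℂ f) x) := by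
    rw [ha, ← hx, ← derivCLM_apply ℂ, map_smul, map_add]
    simp
    ring
  ext x
  rw [annihilationOp_apply, add_apply, creationOp_apply (annihilationOp f), d1, d2,
    creationOp_apply, annihilationOp_apply]
  linear_combination (2 * f x) * sqrt_two_inv_sq

theorem inner_toLp (f g : 𝓢(ℝ, ℂ)) :
    ⟪f.toLp 2 (volume : Measure ℝ), g.toLp 2 volume⟫_ℂ = ∫ x, ⟪f x, g x⟫_ℂ :=
  inner_toL2_toL2_eq f g volume

theorem inner_creationOp (f g : 𝓢(ℝ, ℂ)) :
    ⟪(creationOp f).toLp 2, g.toLp 2⟫_ℂ = ⟪f.toLp 2, (annihilationOp g).toLp 2⟫_ℂ := by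
  rw [inner_toLp, inner_toLp]
  let L : ℂ →L[ℝ] ℂ →L[ℝ] ℂ := (ContinuousLinearMap.mul ℝ ℂ).comp Complex.conjCLE.toContinuousLinearMap
  have hL (z w : ℂ) : L z w = ⟪z, w⟫_ℂ := by
    simp [L, RCLike.inner_apply, mul_comm]
  have hint (f g : 𝓢(ℝ, ℂ)) : Integrable (fun x => L (f x) (g x)) := (pairing L f g).integrable
  have key := integral_bilinear_deriv_right_eq_neg_left f g L
  have h1 (x : ℝ) : ⟪creationOp f x, g x⟫_ℂ =
      ((1 / √2 : ℝ) : ℂ) * (L (f x) (positionOp g x) - L (deriv f x) (g x)) := by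
    simp only [hL, creationOp_apply, positionOp_apply, RCLike.inner_apply, map_mul, map_sub,
      Complex.conj_ofReal]
    ring
  have h2 (x : ℝ) : ⟪f x, annihilationOp g x⟫_ℂ =
      ((1 / √2 : ℝ) : ℂ) * (L (f x) (positionOp g x) + L (f x) (deriv g x)) := by
    simp only [hL, annihilationOp_apply, positionOp_apply, RCLike.inner_apply]
    ring
  have h3 : ∫ x, (L (f x) (positionOp g x) - L (deriv f x) (g x)) =
      (∫ x, L (f x) (positionOp g x)) - ∫ x, L (deriv f x) (g x) :=
    integral_sub (hint f (positionOp g)) (hint (derivCLM ℝ ℂ f) g)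
  have h4 : ∫ x, (L (f x) (positionOp g x) + L (f x) (deriv g x)) =
      (∫ x, L (f x) (positionOp g x)) + ∫ x, L (f x) (deriv g x) :=
    integral_add (hint f (positionOp g)) (hint f (derivCLM ℝ ℂ g))
  simp only [h1, h2]
  rw [integral_const_mul, integral_const_mul, h3, h4, key, sub_eq_add_neg]

theorem annihilationOp_iterate (n : ℕ) :
    annihilationOp (creationOp^[n + 1] vacuumFun) = ((n : ℂ) + 1) • creationOp^[n] vacuumFun := by
  induction n with
  | zero => simp [annihilationOp_creationOp, annihilationOp_vacuumFun]
  | succ n ih =>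
    rw [Function.iterate_succ_apply', annihilationOp_creationOp, ih, map_smul,
      ← Function.iterate_succ_apply' (f := creationOp)]
    push_cast
    module

/-- The wavefunction of the Fock state `|n⟩ = (â†)ⁿ |0⟩ / √(n!)`. -/
def fockFun (n : ℕ) : 𝓢(ℝ, ℂ) :=
  ((1 / √(n.factorial : ℝ) : ℝ) : ℂ) • creationOp^[n] vacuumFun

theorem norm_vacuum : ⟪vacuumFun.toLp 2, vacuumFun.toLp 2⟫_ℂ = 1 := by
  rw [inner_toLp]
  have h (x : ℝ) : ⟪vacuumFun x, vacuumFun x⟫_ℂ =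
      ((Real.pi ^ (-(1 / 2) : ℝ) * Real.exp (-1 * x ^ 2) : ℝ) : ℂ) := by
    rw [vacuumFun_apply, RCLike.inner_apply, Complex.conj_ofReal, ← Complex.ofReal_mul,
      mul_mul_mul_comm, ← Real.exp_add, ← Real.rpow_add Real.pi_pos]
    congr 3 <;> ring_nf
  simp only [h]
  rw [integral_complex_ofReal, integral_const_mul, integral_gaussian, div_one, Real.sqrt_eq_rpow,
    ← Real.rpow_add Real.pi_pos]
  norm_num

theorem inner_iterate (m n : ℕ) :
    ⟪(creationOp^[m] vacuumFun).toLp 2, (creationOp^[n] vacuumFun).toLp 2⟫_ℂ =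
      if m = n then (n.factorial : ℂ) else 0 := by
  have toLp_zero : (0 : 𝓢(ℝ, ℂ)).toLp 2 (volume : Measure ℝ) = 0 := map_zero (toLpCLM ℂ ℂ 2 volume)
  have toLp_smul (c : ℂ) (f : 𝓢(ℝ, ℂ)) : (c • f).toLp 2 (volume : Measure ℝ) = c • f.toLp 2 volume :=
    map_smul (toLpCLM ℂ ℂ 2 volume) c f
  induction m generalizing n with
  | zero =>
    cases n with
    | zero => simpa using norm_vacuum
    | succ n =>
      rw [← inner_conj_symm, Function.iterate_succ_apply', inner_creationOp,
        Function.iterate_zero_apply, annihilationOp_vacuumFun, toLp_zero]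
      simp
  | succ m ih =>
    cases n with
    | zero =>
      rw [Function.iterate_succ_apply', inner_creationOp,
        Function.iterate_zero_apply, annihilationOp_vacuumFun, toLp_zero]
      simp
    | succ n =>
      rw [Function.iterate_succ_apply' _ m, inner_creationOp, annihilationOp_iterate, toLp_smul,
        inner_smul_right, ih]
      simp [Nat.factorial_succ]

theorem orthonormal_fockFun : Orthonormal ℂ (fun n => (fockFun n).toLp 2 (volume : Measure ℝ)) := by
  have toLp_smul (c : ℂ) (f : 𝓢(ℝ, ℂ)) : (c • f).toLp 2 (volume : Measure ℝ) = c • f.toLp 2 volume :=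
    map_smul (toLpCLM ℂ ℂ 2 volume) c f
  rw [orthonormal_iff_ite]
  intro m n
  rw [fockFun, fockFun, toLp_smul, toLp_smul, inner_smul_left, inner_smul_right, inner_iterate]
  split_ifs with h
  · subst h
    rw [Complex.conj_ofReal, ← Complex.ofReal_natCast, ← Complex.ofReal_mul, ← Complex.ofReal_mul,
      ← Complex.ofReal_one]
    congr 1
    have : (0 : ℝ) < m.factorial := by positivity
    have h2 := Real.mul_self_sqrt this.le
    have h3 : √(m.factorial : ℝ) ≠ 0 := by positivity
    field_simp
    nlinarith
  · simp

theorem position_iterate_mem_span (n : ℕ) :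
    positionOp^[n] vacuumFun ∈ Submodule.span ℂ (Set.range fun n => creationOp^[n] vacuumFun) := by
  set K := Submodule.span ℂ (Set.range fun n => creationOp^[n] vacuumFun)
  have hmem (n : ℕ) : creationOp^[n] vacuumFun ∈ K := Submodule.subset_span ⟨n, rfl⟩
  have hx (f : 𝓢(ℝ, ℂ)) : positionOp f = ((1 / √2 : ℝ) : ℂ) • (annihilationOp f + creationOp f) := by
    ext x
    simp only [smul_apply, add_apply, annihilationOp_apply, creationOp_apply, positionOp_apply,
      smul_eq_mul]
    linear_combination (-2 * x * f x) * sqrt_two_inv_sq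
  have hK : K ≤ K.comap (positionOp : 𝓢(ℝ, ℂ) →ₗ[ℂ] 𝓢(ℝ, ℂ)) := by
    rw [Submodule.span_le]
    rintro _ ⟨n, rfl⟩
    change positionOp (creationOp^[n] vacuumFun) ∈ K
    rw [hx, ← Function.iterate_succ_apply' (f := creationOp)]
    refine K.smul_mem _ (K.add_mem ?_ (hmem _))
    cases n with
    | zero => simp [annihilationOp_vacuumFun]
    | succ n => rw [annihilationOp_iterate]; exact K.smul_mem _ (hmem n)
  induction n with
  | zero => exact hmem 0
  | succ n ih => rw [Function.iterate_succ_apply']; exact hK ih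

theorem position_iterate_apply (n : ℕ) (f : 𝓢(ℝ, ℂ)) (x : ℝ) :
    (positionOp^[n] f) x = (x : ℂ) ^ n * f x := by
  induction n with
  | zero => simp
  | succ n ih => rw [Function.iterate_succ_apply', positionOp_apply, ih]; ring

theorem fourier_vacuum_mul_eq_zero {f : ModeSpace}
    (hf : ∀ n : ℕ, ∫ x : ℝ, (x : ℂ) ^ n * vacuumFun x * f x = 0) (t : ℝ) :
    ∫ x : ℝ, Complex.exp (t * x * Complex.I) * (vacuumFun x * f x) = 0 := by
  have hfm : AEStronglyMeasurable (f : ℝ → ℂ) volume := Lp.aestronglyMeasurable f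
  have hv : Continuous vacuumFun := vacuumFun.continuous
  have hexp : MemLp (fun x : ℝ => (Real.exp (|t * x|) * ‖vacuumFun x‖)) 2 := by
    have h0 : MemLp (fun x : ℝ => Real.exp (t ^ 2) * Real.exp (-(1 / 4) * x ^ 2)) 2 := by
      rw [memLp_two_iff_integrable_sq (by fun_prop)]
      have := (integrable_exp_neg_mul_sq (b := 1 / 2) (by norm_num)).const_mul (Real.exp (t ^ 2) ^ 2)
      refine this.congr (Filter.Eventually.of_forall fun x => ?_)
      simp only [mul_pow, ← Real.exp_nat_mul]
      congr 2
      push_cast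
      ring
    refine (h0.const_mul (Real.pi ^ (-(1 / 4) : ℝ))).mono (by fun_prop)
      (Filter.Eventually.of_forall fun x => ?_)
    rw [vacuumFun_apply, Complex.norm_real, norm_mul, norm_norm, Real.norm_eq_abs, Real.norm_eq_abs,
      Real.norm_eq_abs, Real.abs_exp, abs_of_pos (mul_pos (Real.rpow_pos_of_pos Real.pi_pos _) (Real.exp_pos _)),
      abs_of_pos (mul_pos (Real.rpow_pos_of_pos Real.pi_pos _) (mul_pos (Real.exp_pos _) (Real.exp_pos _))),
      mul_left_comm, ← Real.exp_add, ← Real.exp_add]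
    refine mul_le_mul_of_nonneg_left (Real.exp_le_exp.2 ?_)
      (Real.rpow_pos_of_pos Real.pi_pos _).le
    rw [abs_mul]
    nlinarith [sq_nonneg (|t| - |x| / 2), sq_abs t, sq_abs x]
  have hint : Integrable (fun x : ℝ => Real.exp (|t * x|) * ‖vacuumFun x‖ * ‖f x‖) := by
    exact hexp.integrable_mul (Lp.memLp f).norm
  have hs := hasSum_integral_of_dominated_convergence (μ := (volume : Measure ℝ))
    (F := fun (n : ℕ) (x : ℝ) => (t * x * Complex.I) ^ n / n.factorial * (vacuumFun x * f x))
    (f := fun x : ℝ => Complex.exp (t * x * Complex.I) * (vacuumFun x * f x))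
    (fun n x => |t * x| ^ n / n.factorial * (‖vacuumFun x‖ * ‖f x‖))
    (fun n => by fun_prop)
    (fun n => Filter.Eventually.of_forall fun x => by
      simp [abs_mul])
    (Filter.Eventually.of_forall fun x => (Real.summable_pow_div_factorial _).mul_right _)
    (by
      refine hint.congr (Filter.Eventually.of_forall fun x => ?_)
      simp only
      rw [tsum_mul_right, Real.exp_eq_exp_ℝ, NormedSpace.exp_eq_tsum_div, mul_assoc])
    (Filter.Eventually.of_forall fun x => by
      refine HasSum.mul_right _ ?_
      rw [Complex.exp_eq_exp_ℂ]
      exact NormedSpace.expSeries_div_hasSum_exp _)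
  have hz (n : ℕ) : ∫ x : ℝ, (t * x * Complex.I) ^ n / n.factorial * (vacuumFun x * f x) = 0 := by
    have : (fun x : ℝ => (t * x * Complex.I) ^ n / n.factorial * (vacuumFun x * f x)) =
        fun x : ℝ => ((t * Complex.I) ^ n / n.factorial) * ((x : ℂ) ^ n * vacuumFun x * f x) := by
      funext x; ring
    rw [this, integral_const_mul, hf, mul_zero]
  simp only [hz] at hs
  exact hs.unique hasSum_zero

theorem eq_zero_of_inner_fock {f : ModeSpace}
    (hf : ∀ n : ℕ, ⟪(fockFun n).toLp 2 (volume : Measure ℝ), f⟫_ℂ = 0) : f = 0 := by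
  have toLp_smul (c : ℂ) (f : 𝓢(ℝ, ℂ)) :
      (c • f).toLp 2 (volume : Measure ℝ) = c • f.toLp 2 volume :=
    map_smul (toLpCLM ℂ ℂ 2 volume) c f
  have hfm : AEStronglyMeasurable (f : ℝ → ℂ) volume := Lp.aestronglyMeasurable f
  -- all functions `x ^ n * vacuum` are orthogonal to `f`
  have h1 (n : ℕ) : ⟪(positionOp^[n] vacuumFun).toLp 2 (volume : Measure ℝ), f⟫_ℂ = 0 := by
    let φ : 𝓢(ℝ, ℂ) →ₗ[ℂ] ℂ :=
      ((innerSL ℂ f).comp (toLpCLM ℂ ℂ 2 (volume : Measure ℝ))).toLinearMap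
    have hφ : Submodule.span ℂ (Set.range fun n => creationOp^[n] vacuumFun) ≤ LinearMap.ker φ := by
      rw [Submodule.span_le]
      rintro _ ⟨m, rfl⟩
      change ⟪f, (creationOp^[m] vacuumFun).toLp 2 (volume : Measure ℝ)⟫_ℂ = 0
      have h := hf m
      rw [fockFun, toLp_smul, inner_smul_left, mul_eq_zero] at h
      rcases h with h | h
      · have : √(m.factorial : ℝ) ≠ 0 := by positivity
        simp [this] at h
      · rw [← inner_conj_symm, h, map_zero]
    have h : ⟪f, (positionOp^[n] vacuumFun).toLp 2 (volume : Measure ℝ)⟫_ℂ = 0 :=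
      hφ (position_iterate_mem_span n)
    rw [← inner_conj_symm, h, map_zero]
  have h2 (n : ℕ) : ∫ x : ℝ, (x : ℂ) ^ n * vacuumFun x * f x = 0 := by
    rw [← h1 n, L2.inner_def]
    refine integral_congr_ae ?_
    filter_upwards [(positionOp^[n] vacuumFun).coeFn_toLp 2 (volume : Measure ℝ)] with x hx
    rw [hx, RCLike.inner_apply, position_iterate_apply, map_mul, map_pow, Complex.conj_ofReal,
      vacuumFun_apply, Complex.conj_ofReal, mul_comm]
  have hint : Integrable (fun x : ℝ => vacuumFun x * f x) := by
    have := (vacuumFun.memLp 2 (volume : Measure ℝ)).integrable_mul (Lp.memLp f)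
    exact this
  have hF : 𝓕 (fun x : ℝ => vacuumFun x * f x) = 0 := by
    funext t
    rw [Real.fourier_real_eq_integral_exp_smul, Pi.zero_apply,
      ← fourier_vacuum_mul_eq_zero h2 (-2 * Real.pi * t)]
    congr 1
    funext x
    rw [smul_eq_mul]
    congr 2
    push_cast
    ring
  have h3 (g : 𝓢(ℝ, ℂ)) : ∫ x : ℝ, g x * (vacuumFun x * f x) = 0 := by
    have h := VectorFourier.integral_fourierIntegral_smul_eq_flip (L := innerₗ ℝ) (μ := volume)
      (ν := volume) Real.continuous_fourierChar continuous_inner (𝓕⁻ g).integrable hint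
    have e1 : VectorFourier.fourierIntegral Real.fourierChar volume (innerₗ ℝ) (𝓕⁻ g : 𝓢(ℝ, ℂ)) =
        g := by
      change 𝓕 ((𝓕⁻ g : 𝓢(ℝ, ℂ)) : ℝ → ℂ) = g
      rw [← fourier_coe, FourierTransform.fourier_fourierInv_eq]
    have e2 : VectorFourier.fourierIntegral Real.fourierChar volume (innerₗ ℝ).flip
        (fun x : ℝ => vacuumFun x * f x) = 0 := by
      rw [flip_innerₗ]
      exact hF
    rw [e1, e2] at h
    simpa using h
  have h4 : ∀ᵐ x : ℝ, vacuumFun x * f x = 0 := by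
    refine ae_eq_zero_of_integral_contDiff_smul_eq_zero hint.locallyIntegrable ?_
    intro g hg hgs
    have hc : HasCompactSupport (fun x => (g x : ℂ)) := hgs.comp_left (g := Complex.ofReal) rfl
    have hg' : ContDiff ℝ ∞ (fun x => (g x : ℂ)) := Complex.ofRealCLM.contDiff.comp hg
    have h := h3 (hc.toSchwartzMap hg')
    simp only [Complex.real_smul]
    exact h
  refine (Lp.eq_zero_iff_ae_eq_zero).2 ?_
  filter_upwards [h4] with x hx
  have : vacuumFun x ≠ 0 := by
    rw [vacuumFun_apply, Complex.ofReal_ne_zero]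
    exact (mul_pos (Real.rpow_pos_of_pos Real.pi_pos _) (Real.exp_pos _)).ne'
  exact (mul_eq_zero.1 hx).resolve_left this

/-- The Fock basis of `L²(ℝ)`. -/
def fock : HilbertBasis ℕ ℂ ModeSpace :=
  HilbertBasis.mkOfOrthogonalEqBot orthonormal_fockFun (by
    rw [Submodule.eq_bot_iff]
    intro f hf
    refine eq_zero_of_inner_fock fun n => ?_
    exact hf _ (Submodule.subset_span ⟨n, rfl⟩))

theorem fock_apply (n : ℕ) : fock n = (fockFun n).toLp 2 volume := by
  rw [fock, HilbertBasis.coe_mkOfOrthogonalEqBot]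

theorem sqrt_factorial_succ (n : ℕ) :
    √((n + 1).factorial : ℝ) = √((n : ℝ) + 1) * √(n.factorial : ℝ) := by
  rw [Nat.factorial_succ, Nat.cast_mul, Real.sqrt_mul (by positivity)]
  push_cast
  rfl

theorem creationOp_fockFun (n : ℕ) :
    creationOp (fockFun n) = ((√((n : ℝ) + 1) : ℝ) : ℂ) • fockFun (n + 1) := by
  rw [fockFun, fockFun, map_smul, ← Function.iterate_succ_apply' (f := creationOp), smul_smul,
    ← Complex.ofReal_mul]
  congr 2
  rw [sqrt_factorial_succ]
  have h1 : √((n : ℝ) + 1) ≠ 0 := by positivity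
  have h2 : √(n.factorial : ℝ) ≠ 0 := by positivity
  field_simp

theorem annihilationOp_fockFun_zero : annihilationOp (fockFun 0) = 0 := by
  simp [fockFun, annihilationOp_vacuumFun]

theorem annihilationOp_fockFun_succ (n : ℕ) :
    annihilationOp (fockFun (n + 1)) = ((√((n : ℝ) + 1) : ℝ) : ℂ) • fockFun n := by
  rw [fockFun, fockFun, map_smul, annihilationOp_iterate, smul_smul, smul_smul,
    ← Complex.ofReal_natCast, ← Complex.ofReal_one, ← Complex.ofReal_add, ← Complex.ofReal_mul,
    ← Complex.ofReal_mul]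
  congr 2
  rw [sqrt_factorial_succ]
  have h1 : √((n : ℝ) + 1) ≠ 0 := by positivity
  have h2 : √(n.factorial : ℝ) ≠ 0 := by positivity
  field_simp
  rw [Real.sq_sqrt (by positivity)]

/-- Fock states are the eigenstates of the number operator. -/
theorem numberOp_fockFun (n : ℕ) : numberOp (fockFun n) = (n : ℂ) • fockFun n := by
  cases n with
  | zero => simp [numberOp, annihilationOp_fockFun_zero]
  | succ n =>
    simp only [numberOp, ContinuousLinearMap.comp_apply, annihilationOp_fockFun_succ, map_smul,
      creationOp_fockFun, smul_smul]
    rw [← Complex.ofReal_mul, Real.mul_self_sqrt (by positivity)]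
    push_cast
    rfl

theorem orthonormal_phase (θ : ℝ) :
    Orthonormal ℂ (fun n : ℕ => Complex.exp (θ * n * Complex.I) • fock n) := by
  rw [orthonormal_iff_ite]
  intro m n
  rw [inner_smul_left, inner_smul_right, orthonormal_iff_ite.1 fock.orthonormal]
  split_ifs with h
  · subst h
    rw [mul_one, ← Complex.exp_conj, ← Complex.exp_add]
    simp
  · simp

/-- The rephased Fock basis `exp (i θ n) |n⟩`. -/
def phaseFock (θ : ℝ) : HilbertBasis ℕ ℂ ModeSpace :=
  HilbertBasis.mk (orthonormal_phase θ) (by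
    rw [← fock.dense_span]
    refine Submodule.topologicalClosure_mono (Submodule.span_le.2 ?_)
    rintro _ ⟨n, rfl⟩
    have h : fock n = Complex.exp (-(θ * n * Complex.I)) •
        (Complex.exp (θ * n * Complex.I) • fock n) := by
      rw [smul_smul, ← Complex.exp_add]
      simp
    rw [h]
    exact Submodule.smul_mem _ _ (Submodule.subset_span ⟨n, rfl⟩))

/-- The unitary `exp (i θ n̂)`, which maps `|n⟩` to `exp (i θ n) |n⟩`. -/
def numberPhase (θ : ℝ) : ModeSpace ≃ₗᵢ[ℂ] ModeSpace :=
  fock.repr.trans (phaseFock θ).repr.symm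

theorem numberPhase_fock (θ : ℝ) (n : ℕ) :
    numberPhase θ (fock n) = Complex.exp (θ * n * Complex.I) • fock n := by
  classical
  rw [numberPhase, LinearIsometryEquiv.trans_apply, HilbertBasis.repr_self,
    HilbertBasis.repr_symm_single, phaseFock, HilbertBasis.coe_mk]

/-- On Fock states, `exp (i θ n̂) x̂ = q̂_θ exp (i θ n̂)`. -/
theorem numberPhase_position (θ : ℝ) (n : ℕ) :
    numberPhase θ ((positionOp (fockFun n)).toLp 2 volume) =
      Complex.exp (θ * n * Complex.I) • (quadratureOp θ (fockFun n)).toLp 2 volume := by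
  have hx (f : 𝓢(ℝ, ℂ)) : positionOp f =
      ((1 / √2 : ℝ) : ℂ) • (annihilationOp f + creationOp f) := by
    ext x
    simp only [smul_apply, add_apply, annihilationOp_apply, creationOp_apply, positionOp_apply,
      smul_eq_mul]
    linear_combination (-2 * x * f x) * sqrt_two_inv_sq
  have hq (f : 𝓢(ℝ, ℂ)) : quadratureOp θ f = ((1 / √2 : ℝ) : ℂ) •
      (Complex.exp (-(θ * Complex.I)) • annihilationOp f +
        Complex.exp (θ * Complex.I) • creationOp f) := by
    ext x
    simp only [quadratureOp, smul_apply, add_apply, annihilationOp_apply, creationOp_apply, positionOp_apply,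
      momentumOp_apply, smul_eq_mul, ← neg_mul]
    rw [Complex.exp_mul_I, Complex.exp_mul_I, Complex.cos_neg, Complex.sin_neg, Complex.ofReal_cos,
      Complex.ofReal_sin]
    linear_combination
      (-2 * (Complex.cos θ * x * f x - Complex.sin θ * Complex.I * deriv f x)) * sqrt_two_inv_sq
  have toLp_smul (c : ℂ) (f : 𝓢(ℝ, ℂ)) :
      (c • f).toLp 2 (volume : Measure ℝ) = c • f.toLp 2 volume :=
    map_smul (toLpCLM ℂ ℂ 2 volume) c f
  have toLp_add (f g : 𝓢(ℝ, ℂ)) :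
      (f + g).toLp 2 (volume : Measure ℝ) = f.toLp 2 volume + g.toLp 2 volume :=
    map_add (toLpCLM ℂ ℂ 2 volume) f g
  rw [hx, hq, toLp_smul, toLp_smul, map_smul, smul_comm (Complex.exp _)]
  congr 1
  rw [toLp_add, toLp_add, toLp_smul, toLp_smul, map_add, smul_add, creationOp_fockFun, toLp_smul,
    ← fock_apply, map_smul, numberPhase_fock]
  congr 1
  · cases n with
    | zero =>
      have h0 : (0 : 𝓢(ℝ, ℂ)).toLp 2 (volume : Measure ℝ) = 0 := map_zero (toLpCLM ℂ ℂ 2 volume)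
      simp [annihilationOp_fockFun_zero, h0]
    | succ n =>
      rw [annihilationOp_fockFun_succ, toLp_smul, ← fock_apply, map_smul, numberPhase_fock,
        smul_smul, smul_smul, smul_smul, ← Complex.exp_add, mul_comm]
      congr 3
      push_cast
      ring
  · rw [smul_smul, smul_smul, smul_smul, ← Complex.exp_add, mul_comm]
    congr 3
    push_cast
    ring

/-- The spectral projector of the position operator on the measurable set `s`: multiplication by
the indicator function of `s`. -/
def indicatorMul (s : Set ℝ) (hs : MeasurableSet s) : ModeSpace →L[ℂ] ModeSpace :=
  LinearMap.mkContinuous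
    { toFun := fun f => ((Lp.memLp f).indicator hs).toLp (s.indicator f)
      map_add' := fun f g => by
        rw [← MemLp.toLp_add]
        refine MemLp.toLp_congr _ _ ?_
        filter_upwards [Lp.coeFn_add f g] with x hx
        by_cases h : x ∈ s
        · simpa [h] using hx
        · simp [h]
      map_smul' := fun c f => by
        rw [RingHom.id_apply, ← MemLp.toLp_const_smul]
        refine MemLp.toLp_congr _ _ ?_
        filter_upwards [Lp.coeFn_smul c f] with x hx
        by_cases h : x ∈ s
        · simpa [h] using hx
        · simp [h] }
    1 (fun f => by
      rw [one_mul]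
      refine Lp.norm_le_norm_of_ae_le ?_
      filter_upwards [((Lp.memLp f).indicator hs).coeFn_toLp] with x hx
      simp only [LinearMap.coe_mk, AddHom.coe_mk]
      rw [hx]
      exact norm_indicator_le_norm_self _ _)

theorem indicatorMul_apply (s : Set ℝ) (hs : MeasurableSet s) (f : ModeSpace) :
    indicatorMul s hs f =ᵐ[volume] s.indicator f :=
  ((Lp.memLp f).indicator hs).coeFn_toLp

/-- The quadrature projector `∫ |q⟩⟨q|_{q̂_θ} dq` over the window of size `η` around `x`, i.e. the
spectral projector of `q̂_θ = exp (i θ n̂) x̂ exp (-i θ n̂)` on `[x - η/2, x + η/2]`. -/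
def witness (θ x η : ℝ) : ModeSpace →L[ℂ] ModeSpace :=
  (numberPhase θ).toContinuousLinearEquiv.toContinuousLinearMap ∘L
    indicatorMul (Set.Icc (x - η / 2) (x + η / 2)) measurableSet_Icc ∘L
      (numberPhase θ).symm.toContinuousLinearEquiv.toContinuousLinearMap

/-- Matrix elements of the quadrature projector; `exp (-i θ n̂) ψ` is the wavefunction
`q ↦ ⟨q|ψ⟩` of `ψ` in the quadrature `q̂_θ`. -/
theorem inner_witness (θ x η : ℝ) (φ ψ : ModeSpace) :
    ⟪φ, witness θ x η ψ⟫_ℂ = ∫ q in Set.Icc (x - η / 2) (x + η / 2),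
      ⟪(numberPhase θ).symm φ q, (numberPhase θ).symm ψ q⟫_ℂ := by
  have h : ⟪φ, witness θ x η ψ⟫_ℂ = ⟪(numberPhase θ).symm φ,
      indicatorMul (Set.Icc (x - η / 2) (x + η / 2)) measurableSet_Icc
        ((numberPhase θ).symm ψ)⟫_ℂ := by
    conv_lhs => rw [← (numberPhase θ).apply_symm_apply φ]
    exact (numberPhase θ).inner_map_map _ _
  rw [h, L2.inner_def, ← integral_indicator measurableSet_Icc]
  refine integral_congr_ae ?_
  filter_upwards [indicatorMul_apply (Set.Icc (x - η / 2) (x + η / 2)) measurableSet_Icc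
    ((numberPhase θ).symm ψ)] with q hq
  rw [hq]
  by_cases hmem : q ∈ Set.Icc (x - η / 2) (x + η / 2) <;> simp [hmem]

/-- The trace of an operator, as the sum of its diagonal elements in the Fock basis (for a trace
class operator, any orthonormal basis gives the same value). -/
def opTrace (T : ModeSpace →L[ℂ] ModeSpace) : ℂ := ∑' n, ⟪fock n, T (fock n)⟫_ℂ

/-- The trace norm `‖T‖₁ = Tr |T|`, infinite if `T` is not trace class. -/
def traceNorm (T : ModeSpace →L[ℂ] ModeSpace) : ℝ≥0∞ :=
  ∑' n, ENNReal.ofReal (⟪fock n, absOp T (fock n)⟫_ℂ).re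

/-- Quantum states: positive operators of trace norm one. -/
def IsState (ρ : ModeSpace →L[ℂ] ModeSpace) : Prop := ρ.IsPositive ∧ traceNorm ρ = 1

/-- The trace distance `D(ρ, σ) = ‖ρ - σ‖₁ / 2`. -/
def traceDistance (ρ σ : ModeSpace →L[ℂ] ModeSpace) : ℝ := (traceNorm (ρ - σ)).toReal / 2

/-- The projector `|ψ⟩⟨ψ|`. -/
def pureState (ψ : ModeSpace) : ModeSpace →L[ℂ] ModeSpace := InnerProductSpace.rankOne ℂ ψ ψ

/-- The mean energy `⟨n̂⟩_ψ = ∑ n |⟨n|ψ⟩|²`, possibly infinite. -/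
def meanEnergy (ψ : ModeSpace) : ℝ≥0∞ := ∑' n : ℕ, n * ENNReal.ofReal (‖⟪fock n, ψ⟫_ℂ‖ ^ 2)

/-- The set `S^E`: closure in trace norm of the convex hull of the pure states of mean energy at
most `E`. -/
def energyBounded (E : ℝ) : Set (ModeSpace →L[ℂ] ModeSpace) :=
  {ρ | ∀ ε : ℝ≥0∞, 0 < ε → ∃ τ ∈ mixtures {τ : ModeSpace →L[ℂ] ModeSpace | ∃ ψ : ModeSpace,
    ‖ψ‖ = 1 ∧ meanEnergy ψ ≤ ENNReal.ofReal E ∧ τ = pureState ψ}, traceNorm (ρ - τ) < ε}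

/-- The coherent state `|α⟩ = exp (-|α|² / 2) ∑ αⁿ / √(n!) |n⟩`. -/
def coherent (α : ℂ) : ModeSpace :=
  (Real.exp (-(‖α‖ ^ 2 / 2)) : ℂ) • ∑' n : ℕ, (α ^ n / (√(n.factorial : ℝ) : ℂ)) • fock n

/-- The stellar function `F_ψ(α) = exp (|α|² / 2) ⟨α*|ψ⟩`. -/
def stellarFun (ψ : ModeSpace) (α : ℂ) : ℂ :=
  (Real.exp (‖α‖ ^ 2 / 2) : ℂ) * ⟪coherent (starRingEnd ℂ α), ψ⟫_ℂ

/-- The stellar rank of a pure state: the number of zeros, counted with multiplicity, of its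
stellar function (which is entire). -/
def pureStellarRank (ψ : ModeSpace) : ℕ∞ :=
  ⨆ s : Finset ℂ, ∑ z ∈ s, analyticOrderAt (stellarFun ψ) z

/-- `ρ = ∑ p_i |ψ_i⟩⟨ψ_i|` is a (finite or countable) statistical mixture of pure states. -/
def IsDecomposition (ρ : ModeSpace →L[ℂ] ModeSpace) (p : ℕ → ℝ) (ψ : ℕ → ModeSpace) : Prop :=
  (∀ i, 0 ≤ p i) ∧ HasSum p 1 ∧ (∀ i, ‖ψ i‖ = 1) ∧
    HasSum (fun i => (p i : ℂ) • pureState (ψ i)) ρ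

/-- The stellar rank of a mixed state: infimum over its decompositions of the largest stellar rank
of a component. -/
def stellarRank (ρ : ModeSpace →L[ℂ] ModeSpace) : ℕ∞ :=
  sInf {r | ∃ p ψ, IsDecomposition ρ p ψ ∧ r = ⨆ i, pureStellarRank (ψ i)}

/-- The set `S_r^E` of states of stellar rank at most `r` and energy bounded by `E`; for `r = 0`,
the energy-bounded Gaussian states. -/
def rankEnergyBounded (r : ℕ) (E : ℝ) : Set (ModeSpace →L[ℂ] ModeSpace) :=
  {ρ | IsState ρ ∧ ρ ∈ energyBounded E ∧ stellarRank ρ ≤ r}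

/-- The expectation value `Tr (ρ W_{θ,x,η})`, a real number for every state `ρ`. -/
def witnessValue (θ x η : ℝ) (ρ : ModeSpace →L[ℂ] ModeSpace) : ℝ :=
  (opTrace (ρ ∘L witness θ x η)).re

/-- The threshold value `w^E_{θ,x,η}`, the infimum of `Tr (σ W_{θ,x,η})` over `σ ∈ S_0^E`. -/
def threshold (E θ x η : ℝ) : ℝ :=
  ⨅ σ : rankEnergyBounded 0 E, witnessValue θ x η σ

end

end BosonicMode

open BosonicMode

/-!
The witness `W` is an orthogonal projector, so `0 ≤ W ≤ 1`, and the difference of two states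
decomposes as `ρ - σ = A - B` into its positive and negative part. Since `Tr (ρ - σ) = 0` and
`|ρ - σ| = A + B`, one has `Tr A = Tr B = D(ρ, σ)`, hence
`Tr (σ W) - Tr (ρ W) = Tr (B W) - Tr (A W) ≤ Tr B = D(ρ, σ)`
(`witnessValue_sub_le_traceDistance`). Bounding `Tr (σ W)` below by the threshold and taking the
infimum over `σ` gives the claim; the set of such `σ` contains the vacuum, whose stellar function is
constant.

The traces are series in a fixed basis, and their convergence is obtained from Hilbert–Schmidt
operators. If `T` is positive with summable diagonal, `√T` is Hilbert–Schmidt, and cyclicity turns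
`Tr (T W)` into `Tr (√T W √T)`, whose terms are non-negative (`exists_trace_mul`). The parts `A` and
`B` are trace class because each is a compression of `ρ - σ` or of `σ - ρ` to a subspace and is thus
dominated there by `ρ` or `σ` (`summable_trace_posPart`).
-/

namespace BosonicMode

open MeasureTheory

/-! ### Hilbert–Schmidt operators and traces of positive operators -/

section HilbertSchmidt

variable {ι H : Type*} [NormedAddCommGroup H] [InnerProductSpace ℂ H]
  (b : HilbertBasis ι ℂ H)

theorem hasSum_norm_inner_sq (v : H) : HasSum (fun i => ‖⟪b i, v⟫_ℂ‖ ^ 2) (‖v‖ ^ 2) := by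
  have h := Complex.hasSum_re (b.hasSum_inner_mul_inner v v)
  rw [← RCLike.re_eq_complex_re, inner_self_eq_norm_sq] at h
  convert h using 2 with i
  rw [← inner_conj_symm v, ← Complex.normSq_eq_conj_mul_self, Complex.normSq_eq_norm_sq]
  exact (Complex.ofReal_re _).symm

/-- The matrix of a Hilbert–Schmidt operator is square summable. -/
theorem summable_prod_norm_inner_sq {S : H →L[ℂ] H} (hS : Summable fun i => ‖S (b i)‖ ^ 2) :
    Summable fun p : ι × ι => ‖⟪b p.2, S (b p.1)⟫_ℂ‖ ^ 2 := by
  rw [summable_prod_of_nonneg (fun _ => by positivity)]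
  refine ⟨fun i => (hasSum_norm_inner_sq b (S (b i))).summable, ?_⟩
  simpa only [(hasSum_norm_inner_sq b (S (b _))).tsum_eq] using hS

variable [CompleteSpace H]

open ContinuousLinearMap in
theorem norm_inner_adjoint (S : H →L[ℂ] H) (v w : H) :
    ‖⟪v, adjoint S w⟫_ℂ‖ = ‖⟪w, S v⟫_ℂ‖ := by
  rw [adjoint_inner_right, norm_inner_symm]

open ContinuousLinearMap in
/-- The adjoint of a Hilbert–Schmidt operator is Hilbert–Schmidt. -/
theorem summable_norm_sq_adjoint {S : H →L[ℂ] H} (hS : Summable fun i => ‖S (b i)‖ ^ 2) :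
    Summable fun i => ‖adjoint S (b i)‖ ^ 2 := by
  have h := summable_prod_norm_inner_sq b hS
  refine (h.prod_symm.hasSum.prod_fiberwise (g := fun i => ‖adjoint S (b i)‖ ^ 2)
    fun i => ?_).summable
  have h1 := hasSum_norm_inner_sq b (adjoint S (b i))
  simp only [norm_inner_adjoint] at h1
  exact h1

open ContinuousLinearMap in
/-- Cyclicity of the trace for two Hilbert–Schmidt operators, `Tr (S* T) = Tr (T S*)`: both sides
are iterated sums of the same absolutely summable double series. -/
theorem exists_hasSum_inner_and_adjoint {S T : H →L[ℂ] H} (hS : Summable fun i => ‖S (b i)‖ ^ 2)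
    (hT : Summable fun i => ‖T (b i)‖ ^ 2) :
    ∃ c, HasSum (fun i => ⟪S (b i), T (b i)⟫_ℂ) c ∧
      HasSum (fun i => ⟪adjoint T (b i), adjoint S (b i)⟫_ℂ) c := by
  have h : Summable fun p : ι × ι => ⟪S (b p.1), b p.2⟫_ℂ * ⟪b p.2, T (b p.1)⟫_ℂ := by
    refine Summable.of_norm_bounded
      ((summable_prod_norm_inner_sq b hS).add (summable_prod_norm_inner_sq b hT)) fun p => ?_
    rw [norm_mul, norm_inner_symm]
    nlinarith [sq_nonneg (‖⟪b p.2, S (b p.1)⟫_ℂ‖ - ‖⟪b p.2, T (b p.1)⟫_ℂ‖),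
      sq_nonneg ‖⟪b p.2, S (b p.1)⟫_ℂ‖, sq_nonneg ‖⟪b p.2, T (b p.1)⟫_ℂ‖]
  have hswap : HasSum (fun p : ι × ι => ⟪S (b p.2), b p.1⟫_ℂ * ⟪b p.1, T (b p.2)⟫_ℂ) _ :=
    (Equiv.prodComm ι ι).hasSum_iff.2 h.hasSum
  refine ⟨_, h.hasSum.prod_fiberwise fun i =>
    b.hasSum_inner_mul_inner (S (b i)) (T (b i)), hswap.prod_fiberwise fun i => ?_⟩
  have hmul (j : ι) : ⟪S (b j), b i⟫_ℂ * ⟪b i, T (b j)⟫_ℂ =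
      ⟪adjoint T (b i), b j⟫_ℂ * ⟪b j, adjoint S (b i)⟫_ℂ := by
    rw [adjoint_inner_left, adjoint_inner_right, mul_comm]
  simp only [hmul]
  exact b.hasSum_inner_mul_inner _ _

theorem isSelfAdjoint_sqrt (T : H →L[ℂ] H) : IsSelfAdjoint (CFC.sqrt T) :=
  (CFC.sqrt_nonneg T).isSelfAdjoint

theorem inner_sqrt_apply (T : H →L[ℂ] H) (v w : H) :
    ⟪CFC.sqrt T v, w⟫_ℂ = ⟪v, CFC.sqrt T w⟫_ℂ := by
  conv_lhs => rw [← (isSelfAdjoint_sqrt T).adjoint_eq, ContinuousLinearMap.adjoint_inner_left]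

theorem sqrt_apply_sqrt_apply {T : H →L[ℂ] H} (hT : T.IsPositive) (v : H) :
    CFC.sqrt T (CFC.sqrt T v) = T v := by
  rw [← mul_apply_eq_comp,
    CFC.sqrt_mul_sqrt_self T ((ContinuousLinearMap.nonneg_iff_isPositive T).2 hT)]

theorem norm_sqrt_apply_sq {T : H →L[ℂ] H} (hT : T.IsPositive) (v : H) :
    ‖CFC.sqrt T v‖ ^ 2 = (⟪v, T v⟫_ℂ).re := by
  rw [← inner_self_eq_norm_sq (𝕜 := ℂ), inner_sqrt_apply, sqrt_apply_sqrt_apply hT]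
  rfl

open ContinuousLinearMap in
/-- For a positive trace class operator `T` and `0 ≤ W ≤ 1`, the trace of `T W` converges to a real
number between `0` and `Tr T`. With `A = √T`, cyclicity gives `Tr (T W) = Tr (A W A)`, a series
whose terms lie between `0` and `‖A e_i‖²`. -/
theorem exists_trace_mul {T W : H →L[ℂ] H} {t : ℝ} (hT : T.IsPositive)
    (ht : HasSum (fun i => (⟪b i, T (b i)⟫_ℂ).re) t) (hW : W.IsPositive) (hW1 : ‖W‖ ≤ 1) :
    ∃ w : ℝ, 0 ≤ w ∧ w ≤ t ∧ HasSum (fun i => ⟪b i, (T ∘L W) (b i)⟫_ℂ) (w : ℂ) := by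
  set A := CFC.sqrt T with hA
  have hAadj : adjoint A = A := (isSelfAdjoint_sqrt T).adjoint_eq
  have hWadj : adjoint W = W := hW.isSelfAdjoint.adjoint_eq
  simp only [← norm_sqrt_apply_sq hT, ← hA] at ht
  have hWn (v : H) : ‖W v‖ ≤ ‖v‖ := by
    simpa using W.le_of_opNorm_le hW1 v
  have hWA : Summable fun i => ‖(W ∘L A) (b i)‖ ^ 2 :=
    ht.summable.of_nonneg_of_le (fun _ => by positivity) fun i =>
      pow_le_pow_left₀ (norm_nonneg _) (hWn _) 2
  have hAW : Summable fun i => ‖(A ∘L W) (b i)‖ ^ 2 := by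
    simpa only [adjoint_comp, hAadj, hWadj] using summable_norm_sq_adjoint b hWA
  obtain ⟨c, hc, hc'⟩ := exists_hasSum_inner_and_adjoint b ht.summable hAW
  simp only [adjoint_comp, hAadj, hWadj, ContinuousLinearMap.comp_apply] at hc'
  have hval (v : H) : ⟪W v, v⟫_ℂ = ((⟪W v, v⟫_ℂ).re : ℂ) :=
    (Complex.conj_eq_iff_re.1 (by
      rw [inner_conj_symm]; conv_lhs => rw [← hWadj, adjoint_inner_right])).symm
  have hre : HasSum (fun i => (⟪W (A (b i)), A (b i)⟫_ℂ).re) c.re := Complex.hasSum_re hc'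
  have hcre : c = (c.re : ℂ) := by
    refine hc'.unique ?_
    exact (funext fun i => hval (A (b i))) ▸ Complex.hasSum_ofReal.2 hre
  refine ⟨c.re, hre.nonneg fun i => hW.re_inner_nonneg_left _, hasSum_le (fun i => ?_) hre ht, ?_⟩
  · refine (Complex.re_le_norm _).trans ((norm_inner_le_norm _ _).trans ?_)
    rw [sq]
    exact mul_le_mul_of_nonneg_right (hWn _) (norm_nonneg _)
  · rw [← hcre]
    convert hc using 2 with i
    rw [inner_sqrt_apply]
    exact congrArg _ (sqrt_apply_sqrt_apply hT _).symm

open ContinuousLinearMap in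
/-- A compression `P T P` is trace class if `T` is, because `√T P = (P √T)*` is Hilbert–Schmidt. -/
theorem summable_trace_compression {T P : H →L[ℂ] H} (hT : T.IsPositive)
    (ht : Summable fun i => (⟪b i, T (b i)⟫_ℂ).re) (hP : IsSelfAdjoint P) (hP1 : ‖P‖ ≤ 1) :
    Summable fun i => (⟪P (b i), T (P (b i))⟫_ℂ).re := by
  simp only [← norm_sqrt_apply_sq hT] at ht ⊢
  have hPA : Summable fun i => ‖(P ∘L CFC.sqrt T) (b i)‖ ^ 2 :=
    ht.of_nonneg_of_le (fun _ => by positivity) fun i =>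
      pow_le_pow_left₀ (norm_nonneg _) (by simpa using P.le_of_opNorm_le hP1 (CFC.sqrt T (b i))) 2
  simpa only [adjoint_comp, hP.adjoint_eq, (isSelfAdjoint_sqrt T).adjoint_eq,
    ContinuousLinearMap.comp_apply] using summable_norm_sq_adjoint b hPA

/-! ### Positive and negative parts -/

theorem isPositive_posPart (T : H →L[ℂ] H) : T⁺.IsPositive :=
  (ContinuousLinearMap.nonneg_iff_isPositive _).1 (CFC.posPart_nonneg T)

theorem isPositive_negPart (T : H →L[ℂ] H) : T⁻.IsPositive :=
  (ContinuousLinearMap.nonneg_iff_isPositive _).1 (CFC.negPart_nonneg T)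

/-- The positive part of a self-adjoint operator is a compression `P T P` of it: `P` is the
projection onto the closure of the range of `T⁺`, on which `T⁻` vanishes. -/
theorem exists_compression_posPart {T : H →L[ℂ] H} (hT : IsSelfAdjoint T) :
    ∃ P : H →L[ℂ] H, IsSelfAdjoint P ∧ ‖P‖ ≤ 1 ∧ ∀ v, ⟪v, T⁺ v⟫_ℂ = ⟪P v, T (P v)⟫_ℂ := by
  set K : Submodule ℂ H := (LinearMap.range (T⁺ : H →L[ℂ] H).toLinearMap).topologicalClosure
  have : CompleteSpace K :=
    (Submodule.isClosed_topologicalClosure _).completeSpace_coe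
  have hsym (v w : H) : ⟪T⁺ v, w⟫_ℂ = ⟪v, T⁺ w⟫_ℂ := (isPositive_posPart T).isSymmetric v w
  refine ⟨K.starProjection, isSelfAdjoint_starProjection K, K.starProjection_norm_le, fun v => ?_⟩
  have hle : K ≤ LinearMap.ker (T⁻ : H →L[ℂ] H).toLinearMap := by
    refine Submodule.topologicalClosure_minimal _ ?_ T⁻.isClosed_ker
    rintro _ ⟨w, rfl⟩
    exact congrArg (fun S : H →L[ℂ] H => S w) (CFC.negPart_mul_posPart T)
  have hneg : T⁻ (K.starProjection v) = 0 := hle (K.starProjection_apply_mem v)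
  have hpos : T⁺ (K.starProjection v) = T⁺ v := by
    rw [← sub_eq_zero, ← map_sub]
    refine ext_inner_left ℂ fun w => ?_
    rw [← hsym, inner_zero_right, ← neg_sub, inner_neg_right, neg_eq_zero]
    exact Submodule.inner_right_of_mem_orthogonal
      (Submodule.le_topologicalClosure _ (LinearMap.mem_range_self _ w))
      (K.sub_starProjection_mem_orthogonal v)
  have hTP : T (K.starProjection v) = T⁺ v := by
    conv_lhs => rw [← CFC.posPart_sub_negPart T hT]
    rw [sub_apply, hneg, hpos, sub_zero]
  rw [hTP, ← hsym, ← hsym, hpos]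

/-- The positive part of `ρ - σ` is trace class if `ρ` is: it equals a compression
`P (ρ - σ) P`, which is at most `P ρ P`. -/
theorem summable_trace_posPart {ρ σ : H →L[ℂ] H} (hρ : ρ.IsPositive) (hσ : σ.IsPositive)
    (hs : Summable fun i => (⟪b i, ρ (b i)⟫_ℂ).re) :
    Summable fun i => (⟪b i, (ρ - σ)⁺ (b i)⟫_ℂ).re := by
  obtain ⟨P, hP, hP1, hPT⟩ :=
    exists_compression_posPart (hρ.isSelfAdjoint.sub hσ.isSelfAdjoint)
  refine (summable_trace_compression b hρ hs hP hP1).of_nonneg_of_le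
    (fun i => (isPositive_posPart _).re_inner_nonneg_right _) fun i => ?_
  rw [hPT, sub_apply, inner_sub_right, Complex.sub_re]
  have := hσ.re_inner_nonneg_right (P (b i))
  rw [RCLike.re_eq_complex_re] at this
  linarith

theorem absOp_of_isPositive {T : H →L[ℂ] H} (hT : T.IsPositive) : absOp T = T :=
  CFC.abs_of_nonneg T ((ContinuousLinearMap.nonneg_iff_isPositive T).2 hT)

/-- Jordan decomposition of the difference of two positive operators of equal trace: the positive
and the negative part are trace class, of equal trace, and add up to the modulus. -/
theorem exists_sub_eq_and_absOp_sub_eq {ρ σ : H →L[ℂ] H} {r : ℝ} (hρ : ρ.IsPositive)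
    (hσ : σ.IsPositive) (hρr : HasSum (fun i => (⟪b i, ρ (b i)⟫_ℂ).re) r)
    (hσr : HasSum (fun i => (⟪b i, σ (b i)⟫_ℂ).re) r) :
    ∃ (A B : H →L[ℂ] H) (t : ℝ), A.IsPositive ∧ B.IsPositive ∧ ρ - σ = A - B ∧
      absOp (ρ - σ) = A + B ∧ HasSum (fun i => (⟪b i, A (b i)⟫_ℂ).re) t ∧
      HasSum (fun i => (⟪b i, B (b i)⟫_ℂ).re) t := by
  have hT : IsSelfAdjoint (ρ - σ) := hρ.isSelfAdjoint.sub hσ.isSelfAdjoint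
  have hp := summable_trace_posPart b hρ hσ hρr.summable
  have hn := summable_trace_posPart b hσ hρ hσr.summable
  rw [← neg_sub, CFC.posPart_neg] at hn
  have hdiff := hp.hasSum.sub hn.hasSum
  simp only [← Complex.sub_re, ← inner_sub_right, ← sub_apply,
    CFC.posPart_sub_negPart _ hT] at hdiff
  have hzero := hρr.sub hσr
  simp only [← Complex.sub_re, ← inner_sub_right, ← sub_apply] at hzero
  have heq := hdiff.unique hzero
  rw [sub_self, sub_eq_zero] at heq
  exact ⟨_, _, _, isPositive_posPart _, isPositive_negPart _, (CFC.posPart_sub_negPart _ hT).symm,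
    (CFC.posPart_add_negPart _ hT).symm, hp.hasSum, heq ▸ hn.hasSum⟩

end HilbertSchmidt

/-! ### The quadrature projector -/

/-- The expectation of the witness in `v` is the integral of `|⟨q|v⟩|²` over the window. -/
theorem isPositive_witness (θ x η : ℝ) : (witness θ x η).IsPositive := by
  rw [ContinuousLinearMap.isPositive_iff_complex]
  intro v
  have h : ⟪v, witness θ x η v⟫_ℂ = ((∫ q in Set.Icc (x - η / 2) (x + η / 2),
      ‖(numberPhase θ).symm v q‖ ^ 2 : ℝ) : ℂ) := by
    rw [inner_witness, ← integral_complex_ofReal]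
    refine integral_congr_ae (Filter.Eventually.of_forall fun q => ?_)
    simp only [inner_self_eq_norm_sq_to_K, Complex.ofReal_pow]
    rfl
  rw [← inner_conj_symm, h, Complex.conj_ofReal]
  exact ⟨rfl, integral_nonneg fun q => by positivity⟩

theorem norm_witness_le (θ x η : ℝ) : ‖witness θ x η‖ ≤ 1 := by
  refine ContinuousLinearMap.opNorm_le_bound _ zero_le_one fun v => ?_
  have h : ‖indicatorMul (Set.Icc (x - η / 2) (x + η / 2)) measurableSet_Icc‖ ≤ 1 :=
    LinearMap.mkContinuous_norm_le _ zero_le_one _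
  refine ((numberPhase θ).norm_map _).trans_le ?_
  refine (ContinuousLinearMap.le_of_opNorm_le _ h _).trans ?_
  exact (congrArg (1 * ·) ((numberPhase θ).symm.norm_map v)).le

/-! ### Traces and trace distances of states -/

theorem traceNorm_of_isPositive {T : ModeSpace →L[ℂ] ModeSpace} (hT : T.IsPositive) :
    traceNorm T = ∑' n, ENNReal.ofReal (⟪fock n, T (fock n)⟫_ℂ).re := by
  rw [traceNorm, absOp_of_isPositive hT]

theorem traceNorm_zero : traceNorm 0 = 0 := by
  simp [traceNorm_of_isPositive ContinuousLinearMap.isPositive_zero]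

theorem IsState.hasSum_trace {ρ : ModeSpace →L[ℂ] ModeSpace} (hρ : IsState ρ) :
    HasSum (fun n => (⟪fock n, ρ (fock n)⟫_ℂ).re) 1 := by
  have hnn (n : ℕ) : 0 ≤ (⟪fock n, ρ (fock n)⟫_ℂ).re := hρ.1.re_inner_nonneg_right _
  have h := hρ.2
  rw [traceNorm_of_isPositive hρ.1] at h
  have hs := ENNReal.hasSum_toReal (h.trans_ne ENNReal.one_ne_top)
  rw [← ENNReal.tsum_toReal_eq fun n => ENNReal.ofReal_ne_top, h] at hs
  simpa only [ENNReal.toReal_ofReal (hnn _), ENNReal.toReal_one] using hs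

/-- The difference of two states is a difference of positive operators, each of trace equal to the
trace distance. -/
theorem IsState.exists_sub_eq {ρ σ : ModeSpace →L[ℂ] ModeSpace} (hρ : IsState ρ)
    (hσ : IsState σ) : ∃ (A B : ModeSpace →L[ℂ] ModeSpace) (t : ℝ), A.IsPositive ∧
      B.IsPositive ∧ ρ - σ = A - B ∧ HasSum (fun n => (⟪fock n, A (fock n)⟫_ℂ).re) t ∧
      HasSum (fun n => (⟪fock n, B (fock n)⟫_ℂ).re) t ∧
      traceNorm (ρ - σ) = ENNReal.ofReal (2 * t) := by
  obtain ⟨A, B, t, hA, hB, hsub, habs, hAt, hBt⟩ :=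
    exists_sub_eq_and_absOp_sub_eq fock hρ.1 hσ.1 hρ.hasSum_trace hσ.hasSum_trace
  refine ⟨A, B, t, hA, hB, hsub, hAt, hBt, ?_⟩
  have hnn (n : ℕ) : 0 ≤ (⟪fock n, A (fock n)⟫_ℂ).re + (⟪fock n, B (fock n)⟫_ℂ).re :=
    add_nonneg (hA.re_inner_nonneg_right _) (hB.re_inner_nonneg_right _)
  have h := hAt.add hBt
  rw [two_mul, ← h.tsum_eq, ENNReal.ofReal_tsum_of_nonneg hnn h.summable]
  simp only [traceNorm, habs, add_apply, inner_add_right, Complex.add_re]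

theorem traceNorm_sub_ne_top {ρ σ : ModeSpace →L[ℂ] ModeSpace} (hρ : IsState ρ) (hσ : IsState σ) :
    traceNorm (ρ - σ) ≠ ⊤ := by
  obtain ⟨A, B, t, -, -, -, -, -, h⟩ := hρ.exists_sub_eq hσ
  exact h ▸ ENNReal.ofReal_ne_top

/-- The real part taken in `witnessValue` loses nothing when the trace converges to a real number. -/
theorem witnessValue_eq {θ x η w : ℝ} {T : ModeSpace →L[ℂ] ModeSpace}
    (h : HasSum (fun n => ⟪fock n, (T ∘L witness θ x η) (fock n)⟫_ℂ) (w : ℂ)) :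
    witnessValue θ x η T = w := by
  rw [witnessValue, opTrace, h.tsum_eq, Complex.ofReal_re]

theorem IsState.hasSum_witnessValue {σ : ModeSpace →L[ℂ] ModeSpace} (hσ : IsState σ)
    (θ x η : ℝ) : 0 ≤ witnessValue θ x η σ ∧
      HasSum (fun n => ⟪fock n, (σ ∘L witness θ x η) (fock n)⟫_ℂ) (witnessValue θ x η σ : ℂ) := by
  obtain ⟨w, hw, -, h⟩ := exists_trace_mul fock hσ.1 hσ.hasSum_trace (isPositive_witness θ x η)
    (norm_witness_le θ x η)
  rw [witnessValue_eq h]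
  exact ⟨hw, h⟩

/-- The variational bound behind the witness: with `ρ - σ = A - B`,
`Tr (σ W) - Tr (ρ W) = Tr (B W) - Tr (A W) ≤ Tr B = D(ρ, σ)`. -/
theorem witnessValue_sub_le_traceDistance {ρ σ : ModeSpace →L[ℂ] ModeSpace} (hρ : IsState ρ)
    (hσ : IsState σ) (θ x η : ℝ) :
    witnessValue θ x η σ - witnessValue θ x η ρ ≤ traceDistance ρ σ := by
  obtain ⟨A, B, t, hA, hB, hsub, hAt, hBt, hnorm⟩ := hρ.exists_sub_eq hσ
  obtain ⟨a, ha, -, hsa⟩ := exists_trace_mul fock hA hAt (isPositive_witness θ x η)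
    (norm_witness_le θ x η)
  obtain ⟨c, hc0, hc, hsc⟩ := exists_trace_mul fock hB hBt (isPositive_witness θ x η)
    (norm_witness_le θ x η)
  have hdiff := (hρ.hasSum_witnessValue θ x η).2.sub (hσ.hasSum_witnessValue θ x η).2
  have hparts := hsa.sub hsc
  simp only [← inner_sub_right, ← sub_apply, ← ContinuousLinearMap.sub_comp] at hdiff hparts
  rw [hsub] at hdiff
  have h : witnessValue θ x η ρ - witnessValue θ x η σ = a - c := by
    exact_mod_cast hdiff.unique hparts
  rw [traceDistance, hnorm, ENNReal.toReal_ofReal (by linarith)]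
  linarith

/-! ### The vacuum state -/

/-- The unnormalised coefficients of a coherent state are square summable, so the series in
`coherent` converges and does not take the default value `0`. -/
theorem memℓp_coherent (α : ℂ) :
    Memℓp (fun n : ℕ => α ^ n / (√(n.factorial : ℝ) : ℂ)) 2 := by
  refine memℓp_gen ((Real.summable_pow_div_factorial (‖α‖ ^ 2)).congr fun n => ?_)
  rw [ENNReal.toReal_ofNat, Real.rpow_ofNat, norm_div, norm_pow, Complex.norm_real, div_pow,
    Real.norm_eq_abs, sq_abs, Real.sq_sqrt (by positivity)]
  ring

theorem inner_coherent_fock_zero (α : ℂ) :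
    ⟪coherent α, fock 0⟫_ℂ = (Real.exp (-(‖α‖ ^ 2 / 2)) : ℂ) := by
  have h := fock.hasSum_repr_symm ⟨_, memℓp_coherent α⟩
  rw [coherent, h.tsum_eq, ← inner_conj_symm, inner_smul_right, ← fock.repr_apply_apply,
    LinearIsometryEquiv.apply_symm_apply, map_mul, Complex.conj_ofReal]
  simp

theorem stellarFun_vacuum (α : ℂ) : stellarFun (fock 0) α = 1 := by
  rw [stellarFun, inner_coherent_fock_zero, RCLike.norm_conj, ← Complex.ofReal_mul,
    ← Real.exp_add, add_neg_cancel, Real.exp_zero, Complex.ofReal_one]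

theorem pureStellarRank_vacuum : pureStellarRank (fock 0) = 0 := by
  have h (z : ℂ) : analyticOrderAt (stellarFun (fock 0)) z = 0 :=
    analyticOrderAt_eq_zero.2 (Or.inr (by simp [stellarFun_vacuum]))
  simp [pureStellarRank, h]

theorem stellarRank_vacuum : stellarRank (pureState (fock 0)) = 0 := by
  refine le_antisymm (sInf_le ⟨Pi.single 0 1, fun _ => fock 0, ⟨fun i => ?_, hasSum_pi_single 0 1,
    fun _ => fock.orthonormal.1 0, ?_⟩, by simp [pureStellarRank_vacuum]⟩) zero_le
  · exact (Pi.single_nonneg.2 zero_le_one : (0 : ℕ → ℝ) ≤ _) i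
  · convert hasSum_single (f := fun i => ((Pi.single 0 1 : ℕ → ℝ) i : ℂ) • pureState (fock 0)) 0
      (fun i hi => by simp [hi]) using 1
    simp

theorem isState_vacuum : IsState (pureState (fock 0)) := by
  have hpos : (pureState (fock 0)).IsPositive := InnerProductSpace.isPositive_rankOne_self _
  refine ⟨hpos, ?_⟩
  rw [traceNorm_of_isPositive hpos, tsum_eq_single 0]
  · simp [pureState, fock.orthonormal.1]
  · intro n hn
    simp [pureState, inner_smul_right, fock.orthonormal.2 hn]

theorem meanEnergy_vacuum : meanEnergy (fock 0) = 0 := by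
  refine ENNReal.tsum_eq_zero.2 fun n => ?_
  rcases eq_or_ne n 0 with rfl | hn
  · simp
  · simp [fock.orthonormal.2 hn]

/-- The vacuum is a Gaussian state of energy zero, so it obeys every energy bound. -/
theorem vacuum_mem_rankEnergyBounded (E : ℝ) :
    pureState (fock 0) ∈ rankEnergyBounded 0 E := by
  refine ⟨isState_vacuum, fun ε hε => ⟨pureState (fock 0), subset_convexHull ℝ _
    ⟨fock 0, fock.orthonormal.1 0, by simp [meanEnergy_vacuum], rfl⟩, ?_⟩,
    stellarRank_vacuum.le⟩
  rwa [sub_self, traceNorm_zero]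

end BosonicMode

open BosonicMode
theorem corollary4 (x θ η E : ℝ) (hθ : θ ∈ Set.Ico 0 (2 * Real.pi)) (hη : 0 < η) (hE : 0 ≤ E)
    (ρ : ModeSpace →L[ℂ] ModeSpace) (hρ : IsState ρ) :
    -- the quantities below are well defined
    (rankEnergyBounded 0 E).Nonempty ∧
    (∀ σ : ModeSpace →L[ℂ] ModeSpace, IsState σ →
      0 ≤ witnessValue θ x η σ ∧
      HasSum (fun n => ⟪fock n, (σ ∘L witness θ x η) (fock n)⟫_ℂ) (witnessValue θ x η σ : ℂ)) ∧
    (∀ σ ∈ rankEnergyBounded 0 E, traceNorm (ρ - σ) ≠ ⊤) ∧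
    -- the bound on the violation of the witness
    threshold E θ x η - witnessValue θ x η ρ ≤
      ⨅ σ : rankEnergyBounded 0 E, traceDistance ρ σ := by
  have hne : (rankEnergyBounded 0 E).Nonempty := ⟨_, vacuum_mem_rankEnergyBounded E⟩
  refine ⟨hne, fun σ hσ => hσ.hasSum_witnessValue θ x η,
    fun σ hσ => traceNorm_sub_ne_top hρ hσ.1, ?_⟩
  have := hne.to_subtype
  refine le_ciInf fun σ => ?_
  have hbdd : BddBelow (Set.range fun σ : rankEnergyBounded 0 E => witnessValue θ x η σ) := by
    refine ⟨0, ?_⟩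
    rintro _ ⟨τ, rfl⟩
    exact (τ.2.1.hasSum_witnessValue θ x η).1
  exact (sub_le_sub_right (ciInf_le hbdd σ) _).trans
    (witnessValue_sub_le_traceDistance hρ σ.2.1 θ x η)
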